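/- Let $G$ be a finite simple graph having a perfect matching $M$. Let $h$ be the number of connected components of $G\setminus M$ (the graph obtained from $G$ by deleting the edges of $M$) that contain at least one edge. An edge $2$-colouring of $G$ is an assignment of colours to the edges of $G$ (not necessarily proper) such that at most $2$ distinct colours occur on the edges incident with any vertex. Let $OPT$ be the maximum number of colours used in an edge $2$-colouring of $G$. Then: (a) $OPT \le \frac{5}{3}(|M|+h)$; (b) if $G$ is triangle-free, then $OPT \le \frac{8}{5}(|M|+h)$. (In particular both bounds hold if $h$ also counts the isolated vertices of $G\setminus M$ as components.) -/

import Mathlib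

namespace EdgeTwoColoring

variable {V : Type*}

/-- The set of colours that the vertex `v` sees: the colours of the edges of `G` incident with `v`. -/
def colorsAt (G : SimpleGraph V) {K : Type*} (f : G.EdgeLabeling K) (v : V) : Set K :=
  {a | ∃ e : G.edgeSet, v ∈ (e : Sym2 V) ∧ f e = a}

/-- `f` is an edge `q`-colouring of `G`: at most `q` distinct colours are incident at any vertex
(the colouring need not be proper). -/
def IsEdgeColoring (G : SimpleGraph V) (q : ℕ) {K : Type*} (f : G.EdgeLabeling K) : Prop :=
  ∀ v : V, (colorsAt G f v).encard ≤ q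

/-- The possible numbers of colours of an edge `q`-colouring of `G`; surjectivity says that each of
the `k` colours is used on some edge. -/
def colorCounts (G : SimpleGraph V) (q : ℕ) : Set ℕ :=
  {k | ∃ f : G.EdgeLabeling (Fin k), Function.Surjective f ∧ IsEdgeColoring G q f}

/-- The number of colours in an optimal (maximum) edge `q`-colouring of `G`. -/
noncomputable def optColors (G : SimpleGraph V) (q : ℕ) : ℕ :=
  sSup (colorCounts G q)

/-- For a finite graph and `q ≥ 1` the supremum defining `optColors` is attained. -/
theorem isGreatest_optColors [Finite V] (G : SimpleGraph V) {q : ℕ} (hq : 1 ≤ q) :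
    IsGreatest (colorCounts G q) (optColors G q) := by
  have hb : BddAbove (colorCounts G q) := by
    refine ⟨Nat.card G.edgeSet, ?_⟩
    rintro k ⟨f, hf, -⟩
    simpa using Nat.card_le_card_of_surjective f hf
  have hne : (colorCounts G q).Nonempty := by
    rcases isEmpty_or_nonempty G.edgeSet with h | h
    · refine ⟨0, fun e => h.elim e, fun a => a.elim0, fun v => ?_⟩
      have : colorsAt G (fun e : G.edgeSet => (h.elim e : Fin 0)) v = ∅ := by
        ext a
        exact a.elim0
      rw [this]
      simp
    · refine ⟨1, fun _ => 0, fun a => ⟨h.some, Subsingleton.elim _ _⟩, fun v => ?_⟩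
      refine (Set.encard_le_one_iff_subsingleton.2 (Set.subsingleton_of_subsingleton)).trans ?_
      exact_mod_cast hq
  exact ⟨Nat.sSup_mem hne hb, fun k hk => le_csSup hb hk⟩

/-- The number of connected components of `H` that contain at least one edge. -/
noncomputable def numEdgeComponents (H : SimpleGraph V) : ℕ :=
  {C : H.ConnectedComponent | ∃ v w : V, H.Adj v w ∧ H.connectedComponentMk v = C}.ncard

end EdgeTwoColoring

/-! Fix a surjective edge 2-colouring. For a colour c let A be the vertices whose matching edge has
colour c, S those meeting a non-matching edge of colour c, and d the number of components formed by
these edges. A vertex sees at most one colour besides that of its matching edge, so over all colours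
∑|A| = 2|M| and ∑|S \ A| ≤ 2|M|, while `sum_numEdgeComponents_le` gives ∑d ≤ h + ∑|S ∩ A|. Each
colour satisfies a linear inequality in these four quantities (`color_class_bound`,
`color_class_bound_of_triangleFree`), weighted so that ∑|S ∩ A| cancels on summing. -/

namespace EdgeTwoColoring

open SimpleGraph

/-! ### Gluing components of colour classes -/

/-- If every vertex meets at most two of the graphs `Γ c`, namely `Γ (a v)` and `Γ (b v)`, then
the nontrivial components of all the `Γ c` together outnumber those of their union by at most the
number of vertices that meet `Γ (a v)`. -/
theorem sum_numEdgeComponents_le {V K : Type*} [Finite V] [Fintype K] (Γ : K → SimpleGraph V)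
    (a b : V → K) (hab : ∀ v c, v ∈ (Γ c).support → c = a v ∨ c = b v) :
    ∑ c, numEdgeComponents (Γ c) ≤
      numEdgeComponents (⨆ c, Γ c) + {v | v ∈ (Γ (a v)).support}.ncard := by
  classical
  have := Fintype.ofFinite V
  let H := ⨆ c, Γ c
  let P (Δ : SimpleGraph V) : Set Δ.ConnectedComponent :=
    {C | ∃ v w : V, Δ.Adj v w ∧ Δ.connectedComponentMk v = C}
  let X : Set V := {v | v ∈ (Γ (a v)).support}
  let L := Σ c, P (Γ c)
  have hmem : ∀ c v, v ∈ (Γ c).support → (Γ c).connectedComponentMk v ∈ P (Γ c) := by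
    rintro c v ⟨w, hw⟩
    exact ⟨v, w, hw, rfl⟩
  let ev (c : K) (v : V) : (L → ℚ) →ₗ[ℚ] ℚ :=
    if h : v ∈ (Γ c).support then LinearMap.proj (⟨c, ⟨_, hmem c v h⟩⟩ : L) else 0
  have hev : ∀ c v (h : v ∈ (Γ c).support) (g : L → ℚ),
      ev c v g = g ⟨c, ⟨_, hmem c v h⟩⟩ := by
    intro c v h g
    simp [ev, h]
  have hcol : ∀ v, ∃ c, (∃ c', v ∈ (Γ c').support) → v ∈ (Γ c).support := by
    intro v
    by_cases h : ∃ c', v ∈ (Γ c').support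
    · exact ⟨h.choose, fun _ => h.choose_spec⟩
    · exact ⟨a v, fun h' => (h h').elim⟩
  choose col hcol using hcol
  let rep (C : P H) : V := C.2.choose
  have hrep : ∀ C : P H, H.connectedComponentMk (rep C) = C := by
    intro C
    obtain ⟨w, -, h⟩ := C.2.choose_spec
    exact h
  let diff (v : X) : (L → ℚ) →ₗ[ℚ] ℚ :=
    if (v : V) ∈ (Γ (b v)).support then ev (a v) v - ev (b v) v else 0
  -- A function in the kernel agrees on pieces sharing a vertex and vanishes on one piece of each
  -- component of the union, so it is zero; comparing dimensions gives the bound.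
  let Φ : (L → ℚ) →ₗ[ℚ] (P H → ℚ) × (X → ℚ) :=
    (LinearMap.pi fun C => ev (col (rep C)) (rep C)).prod (LinearMap.pi diff)
  have hΦ : Function.Injective Φ := by
    rw [injective_iff_map_eq_zero]
    intro g hg
    have h1 : ∀ C : P H, ev (col (rep C)) (rep C) g = 0 := fun C =>
      congrFun (congrArg Prod.fst hg) C
    have h2 : ∀ v : X, diff v g = 0 := fun v => congrFun (congrArg Prod.snd hg) v
    have h3 : ∀ v, v ∈ (Γ (a v)).support → v ∈ (Γ (b v)).support →
        ev (a v) v g = ev (b v) v g := by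
      intro v ha hb
      have := h2 ⟨v, ha⟩
      simp only [diff, hb, if_true, LinearMap.sub_apply] at this
      exact sub_eq_zero.1 this
    have h4 : ∀ v c c', v ∈ (Γ c).support → v ∈ (Γ c').support → ev c v g = ev c' v g := by
      intro v c c' hc hc'
      rcases hab v c hc with rfl | rfl <;> rcases hab v c' hc' with h | h
      · rw [h]
      · subst h; exact h3 v hc hc'
      · subst h; exact (h3 v hc' hc).symm
      · rw [h]
    have h5 : ∀ u v, H.Adj u v → ev (col u) u g = ev (col v) v g := by
      intro u v huv
      obtain ⟨c, hc⟩ := (SimpleGraph.iSup_adj).1 huv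
      have hu : u ∈ (Γ c).support := ⟨v, hc⟩
      have hv : v ∈ (Γ c).support := ⟨u, hc.symm⟩
      rw [h4 u _ c (hcol u ⟨c, hu⟩) hu, h4 v _ c (hcol v ⟨c, hv⟩) hv, hev c u hu, hev c v hv]
      congr 3
      exact ConnectedComponent.sound hc.reachable
    have h6 : ∀ u v, H.Reachable u v → ev (col u) u g = ev (col v) v g := by
      rintro u v ⟨p⟩
      induction p with
      | nil => rfl
      | cons h _ ih => exact (h5 _ _ h).trans ih
    ext ⟨c, C, u, w, huw, rfl⟩
    have hu : u ∈ (Γ c).support := ⟨w, huw⟩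
    have hH : H.Adj u w := SimpleGraph.iSup_adj.2 ⟨c, huw⟩
    have hC := hrep ⟨H.connectedComponentMk u, u, w, hH, rfl⟩
    have := h1 ⟨H.connectedComponentMk u, u, w, hH, rfl⟩
    rw [h6 _ _ (ConnectedComponent.exact hC), h4 u _ c (hcol u ⟨c, hu⟩) hu, hev c u hu] at this
    exact this
  have hcard := LinearMap.finrank_le_finrank_of_injective hΦ
  rw [Module.finrank_prod, Module.finrank_fintype_fun_eq_card, Module.finrank_fintype_fun_eq_card,
    Module.finrank_fintype_fun_eq_card, Fintype.card_sigma] at hcard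
  simp only [← Nat.card_eq_fintype_card] at hcard
  exact hcard

/-! ### Inequalities for a single colour -/

section ColorClass

variable {V : Type*} [Finite V] {Γ : SimpleGraph V} {A : Set V} {mate : V → V}

theorem one_le_numEdgeComponents (h : Γ.support.Nonempty) : 1 ≤ numEdgeComponents Γ := by
  obtain ⟨v, w, h⟩ := h
  exact (Set.ncard_pos).2 ⟨_, v, w, h, rfl⟩

theorem two_le_ncard_support (h : Γ.support.Nonempty) : 2 ≤ Γ.support.ncard := by
  obtain ⟨v, w, h⟩ := h
  rw [← Set.ncard_pair h.ne]
  exact Set.ncard_le_ncard (Set.pair_subset ⟨w, h⟩ ⟨v, h.symm⟩)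

theorem eq_pair_of_ncard_eq_two (hne : ∀ v, mate v ≠ v) (hA : ∀ v ∈ A, mate v ∈ A)
    (h2 : A.ncard = 2) {v : V} (hv : v ∈ A) : A = {v, mate v} :=
  (Set.eq_of_subset_of_ncard_le (Set.pair_subset hv (hA v hv))
    (by rw [h2, Set.ncard_pair (hne v).symm])).symm

/-- A graph avoiding the matching edges, with support contained in one matching edge, has no edges. -/
theorem support_eq_empty_of_ncard_eq_two (hne : ∀ v, mate v ≠ v) (hA : ∀ v ∈ A, mate v ∈ A)
    (hadj : ∀ v, ¬ Γ.Adj v (mate v)) (h2 : A.ncard = 2) (hs : Γ.support ⊆ A) :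
    Γ.support = ∅ := by
  rw [Set.eq_empty_iff_forall_notMem]
  rintro v ⟨w, hvw⟩
  have hw : w ∈ A := hs ⟨v, hvw.symm⟩
  rw [eq_pair_of_ncard_eq_two hne hA h2 (hs ⟨w, hvw⟩)] at hw
  rcases hw with rfl | rfl
  · exact hvw.ne rfl
  · exact hadj _ hvw

/-- Both ends of the single matching edge have neighbours outside `A`; a common one would close a
triangle. -/
theorem two_le_ncard_support_diff (hne : ∀ v, mate v ≠ v)
    (hA : ∀ v ∈ A, mate v ∈ A) (hadj : ∀ v, ¬ Γ.Adj v (mate v))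
    (htri : ∀ x v, Γ.Adj x v → ¬ Γ.Adj x (mate v)) (h2 : A.ncard = 2) (hs : A ⊆ Γ.support) :
    2 ≤ (Γ.support \ A).ncard := by
  obtain ⟨u, hu⟩ : A.Nonempty := Set.nonempty_of_ncard_ne_zero (by omega)
  have hAu := eq_pair_of_ncard_eq_two hne hA h2 hu
  obtain ⟨x, hx⟩ := hs hu
  obtain ⟨y, hy⟩ := hs (hA u hu)
  have hxA : x ∉ A := by
    rw [hAu]
    rintro (rfl | rfl)
    · exact hx.ne rfl
    · exact hadj _ hx
  have hyA : y ∉ A := by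
    rw [hAu]
    rintro (rfl | rfl)
    · exact hadj _ hy.symm
    · exact hy.ne rfl
  have hxy : x ≠ y := by
    rintro rfl
    exact htri x u hx.symm hy.symm
  rw [← Set.ncard_pair hxy]
  exact Set.ncard_le_ncard (Set.pair_subset ⟨⟨u, hx.symm⟩, hxA⟩ ⟨⟨_, hy.symm⟩, hyA⟩)

/-- A triangle-free graph living on exactly two matching edges is disconnected once the matching
edges are removed. -/
theorem two_le_numEdgeComponents (hinv : ∀ v, mate (mate v) = v) (hne : ∀ v, mate v ≠ v)
    (hA : ∀ v ∈ A, mate v ∈ A) (hadj : ∀ v, ¬ Γ.Adj v (mate v))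
    (htri : ∀ x v, Γ.Adj x v → ¬ Γ.Adj x (mate v)) (h4 : A.ncard = 4) (hs : Γ.support = A) :
    2 ≤ numEdgeComponents Γ := by
  obtain ⟨u, hu⟩ : A.Nonempty := Set.nonempty_of_ncard_ne_zero (by omega)
  obtain ⟨v, huv⟩ : u ∈ Γ.support := hs ▸ hu
  have hv : v ∈ A := hs ▸ (⟨u, huv.symm⟩ : v ∈ Γ.support)
  have hvu : v ≠ mate u := by
    rintro rfl
    exact hadj _ huv
  have hmm : mate u ≠ mate v := fun h => huv.ne (by rw [← hinv u, h, hinv])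
  have hum : u ≠ mate v := fun h => hvu (by rw [h, hinv])
  have hAe : A = {u, mate u, v, mate v} := by
    symm
    refine Set.eq_of_subset_of_ncard_le ?_ ?_
    · simp only [Set.insert_subset_iff, Set.singleton_subset_iff]
      exact ⟨hu, hA u hu, hv, hA v hv⟩
    · rw [h4, Set.ncard_insert_of_notMem, Set.ncard_insert_of_notMem, Set.ncard_pair (hne v).symm]
      · simp [hvu.symm, hmm]
      · simp [(hne u).symm, huv.ne, hum]
  -- Within `A`, `mate u` is excluded by the matching and `mate v` by triangles, so the edge `uv` is
  -- a whole component.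
  have hnu : ∀ w, Γ.Adj u w → w = v := by
    intro w hw
    have : w ∈ A := hs ▸ (⟨u, hw.symm⟩ : w ∈ Γ.support)
    rw [hAe] at this
    rcases this with rfl | rfl | rfl | rfl
    · exact (hw.ne rfl).elim
    · exact (hadj _ hw).elim
    · rfl
    · exact (htri _ _ huv hw).elim
  have hnv : ∀ w, Γ.Adj v w → w = u := by
    intro w hw
    have : w ∈ A := hs ▸ (⟨v, hw.symm⟩ : w ∈ Γ.support)
    rw [hAe] at this
    rcases this with rfl | rfl | rfl | rfl
    · rfl
    · exact (htri _ _ huv.symm hw).elim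
    · exact (hw.ne rfl).elim
    · exact (hadj _ hw).elim
  have hreach : ∀ x y, Γ.Reachable x y → (x = u ∨ x = v) → (y = u ∨ y = v) := by
    rintro x y ⟨p⟩
    induction p with
    | nil => exact id
    | cons h _ ih =>
      rintro (rfl | rfl)
      · exact ih (Or.inr (hnu _ h))
      · exact ih (Or.inl (hnv _ h))
  obtain ⟨w, hw⟩ : mate u ∈ Γ.support := hs ▸ hA u hu
  have hC : Γ.connectedComponentMk u ≠ Γ.connectedComponentMk (mate u) := by
    intro h
    rcases hreach _ _ (ConnectedComponent.exact h) (Or.inl rfl) with h | h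
    · exact hne _ h
    · exact hvu h.symm
  rw [← Set.ncard_pair hC]
  exact Set.ncard_le_ncard (Set.pair_subset ⟨u, v, huv, rfl⟩ ⟨mate u, w, hw, rfl⟩)

/-- For |A| ≥ 6, |S ∩ A| ≤ |A| suffices; parity leaves 0, 2 and 4. A single edge with `A` empty
gives equality. -/
theorem color_class_bound (hne : ∀ v, mate v ≠ v)
    (hA : ∀ v ∈ A, mate v ∈ A) (hadj : ∀ v, ¬ Γ.Adj v (mate v)) (heven : Even A.ncard)
    (hnonempty : A = ∅ → Γ.support.Nonempty) :
    6 + 2 * (Γ.support ∩ A).ncard ≤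
      3 * A.ncard + 2 * numEdgeComponents Γ + 2 * (Γ.support \ A).ncard := by
  have hsum := Set.ncard_inter_add_ncard_sdiff_eq_ncard Γ.support A
  have hsA : (Γ.support ∩ A).ncard ≤ A.ncard := Set.ncard_le_ncard Set.inter_subset_right
  have hd : 0 < Γ.support.ncard → 1 ≤ numEdgeComponents Γ := fun h =>
    one_le_numEdgeComponents ((Set.ncard_pos).1 h)
  have h0 : A.ncard = 0 → 2 ≤ Γ.support.ncard := fun h =>
    two_le_ncard_support (hnonempty ((Set.ncard_eq_zero).1 h))
  have h2 : A.ncard = 2 → (Γ.support \ A).ncard = 0 → Γ.support.ncard = 0 := by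
    intro h hw
    rw [Set.ncard_eq_zero, Set.sdiff_eq_empty] at hw
    rw [support_eq_empty_of_ncard_eq_two hne hA hadj h hw, Set.ncard_empty]
  obtain ⟨r, hr⟩ := heven
  omega

/-- Triangle-freeness matters only when A ⊆ S: for |A| = 2 it forces |S \ A| ≥ 2, and for |A| = 4
with S = A it forces d ≥ 2. -/
theorem color_class_bound_of_triangleFree (hinv : ∀ v, mate (mate v) = v)
    (hne : ∀ v, mate v ≠ v)
    (hA : ∀ v ∈ A, mate v ∈ A) (hadj : ∀ v, ¬ Γ.Adj v (mate v)) (heven : Even A.ncard)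
    (hnonempty : A = ∅ → Γ.support.Nonempty)
    (htri : ∀ x v, Γ.Adj x v → ¬ Γ.Adj x (mate v)) :
    10 + 4 * (Γ.support ∩ A).ncard ≤
      5 * A.ncard + 4 * numEdgeComponents Γ + 3 * (Γ.support \ A).ncard := by
  have hsum := Set.ncard_inter_add_ncard_sdiff_eq_ncard Γ.support A
  have hsA : (Γ.support ∩ A).ncard ≤ A.ncard := Set.ncard_le_ncard Set.inter_subset_right
  have hd : 0 < Γ.support.ncard → 1 ≤ numEdgeComponents Γ := fun h =>
    one_le_numEdgeComponents ((Set.ncard_pos).1 h)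
  have h0 : A.ncard = 0 → 2 ≤ Γ.support.ncard := fun h =>
    two_le_ncard_support (hnonempty ((Set.ncard_eq_zero).1 h))
  have h2 : A.ncard = 2 → (Γ.support \ A).ncard = 0 → Γ.support.ncard = 0 := by
    intro h hw
    rw [Set.ncard_eq_zero, Set.sdiff_eq_empty] at hw
    rw [support_eq_empty_of_ncard_eq_two hne hA hadj h hw, Set.ncard_empty]
  have hsub : (Γ.support ∩ A).ncard = A.ncard → A ⊆ Γ.support := fun h =>
    Set.inter_eq_right.1 (Set.eq_of_subset_of_ncard_le Set.inter_subset_right h.ge)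
  have h2' : A.ncard = 2 → (Γ.support ∩ A).ncard = A.ncard → 2 ≤ (Γ.support \ A).ncard :=
    fun h hs => two_le_ncard_support_diff hne hA hadj htri h (hsub hs)
  have h4 : A.ncard = 4 → (Γ.support ∩ A).ncard = A.ncard → (Γ.support \ A).ncard = 0 →
      2 ≤ numEdgeComponents Γ := by
    intro h hs hw
    rw [Set.ncard_eq_zero, Set.sdiff_eq_empty] at hw
    exact two_le_numEdgeComponents hinv hne hA hadj htri h (hw.antisymm (hsub hs))
  obtain ⟨r, hr⟩ := heven
  omega

end ColorClass

/-! ### Counting over colours and matching edges -/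

theorem sum_ncard_fiber {V K : Type*} [Finite V] [Fintype K] (p : Set V) (g : V → K) :
    ∑ c, {v | v ∈ p ∧ g v = c}.ncard = p.ncard := by
  classical
  have := Fintype.ofFinite V
  rw [Set.ncard_eq_toFinset_card' p,
    Finset.card_eq_sum_card_fiberwise (f := g) (t := Finset.univ) (by simp)]
  refine Finset.sum_congr rfl fun c _ => ?_
  rw [Set.ncard_eq_toFinset_card']
  congr 1
  ext v
  simp

/-- A set of vertices that is a union of edges of a perfect matching has twice as many elements as
it has matching edges. -/
theorem ncard_setOf_mk_mate_mem {V : Type*} [Finite V] {mate : V → V}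
    (hinv : ∀ v, mate (mate v) = v) (hne : ∀ v, mate v ≠ v) (P : Set (Sym2 V))
    (hP : ∀ e ∈ P, ∃ v, s(v, mate v) = e) :
    {v | s(v, mate v) ∈ P}.ncard = 2 * P.ncard := by
  classical
  have := Fintype.ofFinite V
  rw [Set.ncard_eq_toFinset_card', Set.ncard_eq_toFinset_card' P,
    Finset.card_eq_sum_card_fiberwise (f := fun v => s(v, mate v)) (t := P.toFinset)
      (fun v hv => by simpa using hv),
    Finset.sum_const_nat (m := 2), mul_comm]
  intro e he
  obtain ⟨v, rfl⟩ := hP e (by simpa using he)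
  rw [← Finset.card_pair (hne v).symm]
  congr 1
  ext w
  simp only [Finset.mem_filter, Set.mem_toFinset, Set.mem_ofPred_eq, Finset.mem_insert,
    Finset.mem_singleton, Sym2.eq_iff] at he ⊢
  constructor
  · rintro ⟨-, ⟨h, -⟩ | ⟨h, -⟩⟩
    · exact Or.inl h
    · exact Or.inr h
  · rintro (rfl | rfl)
    · exact ⟨he, Or.inl ⟨rfl, rfl⟩⟩
    · rw [hinv, Sym2.eq_swap]
      exact ⟨he, Or.inr ⟨rfl, rfl⟩⟩

theorem iSup_labelGraph_deleteEdges {V K : Type*} {G : SimpleGraph V} (f : G.EdgeLabeling K)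
    (s : Set (Sym2 V)) :
    ⨆ c, (f.labelGraph c).deleteEdges s = G.deleteEdges s := by
  ext u v
  simp only [iSup_adj, deleteEdges_adj, EdgeLabeling.labelGraph_adj]
  constructor
  · rintro ⟨c, ⟨h, -⟩, hs⟩
    exact ⟨h, hs⟩
  · rintro ⟨h, hs⟩
    exact ⟨_, ⟨h, rfl⟩, hs⟩

/-- Besides a given colour, a vertex of an edge `2`-colouring sees at most one other. -/
theorem IsEdgeColoring.exists_other_color {V K : Type*} {G : SimpleGraph V} {f : G.EdgeLabeling K}
    (hf : IsEdgeColoring G 2 f) {v : V} {a : K} (ha : a ∈ colorsAt G f v) :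
    ∃ b, ∀ c ∈ colorsAt G f v, c = a ∨ c = b := by
  by_cases h : ∃ b ∈ colorsAt G f v, b ≠ a
  · obtain ⟨b, hb, hba⟩ := h
    refine ⟨b, fun c hc => ?_⟩
    by_contra! hcab
    have h3 : ({c, a, b} : Set K).encard = 3 :=
      Set.encard_eq_three.2 ⟨c, a, b, hcab.1, hcab.2, hba.symm, rfl⟩
    have hsub : ({c, a, b} : Set K) ⊆ colorsAt G f v := by
      simp only [Set.insert_subset_iff, Set.singleton_subset_iff]
      exact ⟨hc, ha, hb⟩
    have := (Set.encard_le_encard hsub).trans (hf v)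
    rw [h3] at this
    exact absurd this (by decide)
  · push Not at h
    exact ⟨a, fun c hc => Or.inl (h c hc)⟩

/-! ### Summing over the colours -/

theorem card_colors_bounds {V K : Type*} [Finite V] [Fintype K] {G : SimpleGraph V}
    {M : G.Subgraph} (hM : M.IsPerfectMatching) {f : G.EdgeLabeling K}
    (hsurj : Function.Surjective f) (hf : IsEdgeColoring G 2 f) :
    6 * Fintype.card K ≤
      10 * M.edgeSet.ncard + 2 * numEdgeComponents (G.deleteEdges M.edgeSet) ∧
    (G.CliqueFree 3 → 10 * Fintype.card K ≤
      16 * M.edgeSet.ncard + 4 * numEdgeComponents (G.deleteEdges M.edgeSet)) := by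
  classical
  choose mate hmate huniq using Subgraph.isPerfectMatching_iff.1 hM
  have hinv : ∀ v, mate (mate v) = v := fun v => (huniq _ v (hmate v).symm).symm
  have hne : ∀ v, mate v ≠ v := fun v h => (hmate v).ne h.symm
  have hedge : ∀ e ∈ M.edgeSet, ∃ v, s(v, mate v) = e := by
    intro e he
    induction e with
    | _ v w => exact ⟨v, by rw [huniq v w he]⟩
  let a (v : V) : K := f ⟨s(v, mate v), (hmate v).adj_sub⟩
  have ha_mate : ∀ v, a (mate v) = a v := by
    intro v
    simp only [a, hinv, Sym2.eq_swap]
  let Γ (c : K) : SimpleGraph V := (f.labelGraph c).deleteEdges M.edgeSet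
  have hΓ : ∀ c u v, (Γ c).Adj u v ↔
      (∃ h : G.Adj u v, f ⟨s(u, v), h⟩ = c) ∧ s(u, v) ∉ M.edgeSet := by
    intro c u v
    simp only [Γ, deleteEdges_adj, EdgeLabeling.labelGraph_adj]
  have hcol : ∀ v c, v ∈ (Γ c).support → c ∈ colorsAt G f v := by
    rintro v c ⟨w, hw⟩
    obtain ⟨⟨h, hc⟩, -⟩ := (hΓ c v w).1 hw
    exact ⟨_, Sym2.mem_mk_left v w, hc⟩
  have ha_col : ∀ v, a v ∈ colorsAt G f v := fun v => ⟨_, Sym2.mem_mk_left v (mate v), rfl⟩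
  choose b hb using fun v => hf.exists_other_color (ha_col v)
  have hadj : ∀ c v, ¬ (Γ c).Adj v (mate v) := fun c v h => ((hΓ c _ _).1 h).2 (hmate v)
  let A (c : K) : Set V := {v | a v = c}
  have hA : ∀ c, ∀ v ∈ A c, mate v ∈ A c := fun c v hv => (ha_mate v).trans hv
  have heven : ∀ c, Even (A c).ncard := by
    intro c
    have := ncard_setOf_mk_mate_mem hinv hne
      {e | ∃ h : e ∈ M.edgeSet, f ⟨e, M.edgeSet_subset h⟩ = c} (fun e he => hedge e he.1)
    refine ⟨_, Eq.trans ?_ (this.trans (two_mul _))⟩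
    congr 1
    ext v
    exact ⟨fun h => ⟨hmate v, h⟩, fun h => h.2⟩
  have hnonempty : ∀ c, A c = ∅ → (Γ c).support.Nonempty := by
    intro c hc
    obtain ⟨⟨e, he⟩, hfe⟩ := hsurj c
    induction e with
    | _ u v =>
      refine ⟨u, v, (hΓ c u v).2 ⟨⟨he, hfe⟩, fun hm => ?_⟩⟩
      have hv := huniq u v hm
      subst hv
      exact (Set.eq_empty_iff_forall_notMem.1 hc) u hfe
  have hn : (Set.univ : Set V).ncard = 2 * M.edgeSet.ncard := by
    rw [← ncard_setOf_mk_mate_mem hinv hne M.edgeSet hedge]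
    congr 1
    ext v
    exact ⟨fun _ => hmate v, fun _ => trivial⟩
  have hsumA : ∑ c, (A c).ncard = 2 * M.edgeSet.ncard := by
    rw [← hn, ← sum_ncard_fiber Set.univ a]
    simp [A]
  have hsumS : ∑ c, ((Γ c).support ∩ A c).ncard = {v | v ∈ (Γ (a v)).support}.ncard := by
    rw [← sum_ncard_fiber _ a]
    refine Finset.sum_congr rfl fun c _ => congrArg Set.ncard ?_
    ext v
    constructor
    · rintro ⟨h, rfl⟩
      exact ⟨h, rfl⟩
    · rintro ⟨h, rfl⟩
      exact ⟨h, rfl⟩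
  -- A vertex of S \ A for colour `c` must have `b v = c`, so it is counted for one colour only.
  have hsumW : ∑ c, ((Γ c).support \ A c).ncard ≤ 2 * M.edgeSet.ncard := by
    rw [← hn, ← sum_ncard_fiber Set.univ b]
    refine Finset.sum_le_sum fun c _ => Set.ncard_le_ncard ?_
    rintro v ⟨hv, hva⟩
    exact ⟨trivial, ((hb v c (hcol v c hv)).resolve_left fun h => hva h.symm).symm⟩
  have hcomp := sum_numEdgeComponents_le Γ a b fun v c hv => hb v c (hcol v c hv)
  rw [← hsumS, iSup_labelGraph_deleteEdges f M.edgeSet] at hcomp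
  constructor
  · have := Finset.sum_le_sum fun c (_ : c ∈ Finset.univ) =>
      color_class_bound hne (hA c) (hadj c) (heven c) (hnonempty c)
    simp only [Finset.sum_add_distrib, ← Finset.mul_sum, Finset.sum_const, Finset.card_univ,
      smul_eq_mul] at this
    omega
  · intro hG
    have htri : ∀ c x v, (Γ c).Adj x v → ¬ (Γ c).Adj x (mate v) := by
      intro c x v h1 h2
      refine hG {x, v, mate v} (is3Clique_triple_iff.2 ⟨?_, ?_, (hmate v).adj_sub⟩)
      · exact ((hΓ c _ _).1 h1).1.1
      · exact ((hΓ c _ _).1 h2).1.1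
    have := Finset.sum_le_sum fun c (_ : c ∈ Finset.univ) =>
      color_class_bound_of_triangleFree hinv hne (hA c) (hadj c) (heven c) (hnonempty c) (htri c)
    simp only [Finset.sum_add_distrib, ← Finset.mul_sum, Finset.sum_const, Finset.card_univ,
      smul_eq_mul] at this
    omega

end EdgeTwoColoring

theorem theorem1 {V : Type*} [Finite V] (G : SimpleGraph V) (M : G.Subgraph)
    (hM : M.IsPerfectMatching) :
    ((EdgeTwoColoring.optColors G 2 : ℝ) ≤
      5 / 3 * ((M.edgeSet.ncard : ℝ) +
        (EdgeTwoColoring.numEdgeComponents (G.deleteEdges M.edgeSet) : ℝ))) ∧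
    (G.CliqueFree 3 →
      (EdgeTwoColoring.optColors G 2 : ℝ) ≤
        8 / 5 * ((M.edgeSet.ncard : ℝ) +
          (EdgeTwoColoring.numEdgeComponents (G.deleteEdges M.edgeSet) : ℝ))) := by
  obtain ⟨f, hsurj, hf⟩ := (EdgeTwoColoring.isGreatest_optColors G one_le_two).1
  obtain ⟨h1, h2⟩ := EdgeTwoColoring.card_colors_bounds hM hsurj hf
  rw [Fintype.card_fin] at h1 h2
  -- The bounds obtained carry h with the smaller coefficients 1/3 and 2/5.
  have hh : (0 : ℝ) ≤ EdgeTwoColoring.numEdgeComponents (G.deleteEdges M.edgeSet) :=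
    Nat.cast_nonneg _
  refine ⟨?_, fun hG => ?_⟩
  · have : (6 * EdgeTwoColoring.optColors G 2 : ℝ) ≤ 10 * M.edgeSet.ncard +
        2 * EdgeTwoColoring.numEdgeComponents (G.deleteEdges M.edgeSet) := by exact_mod_cast h1
    linarith
  · have : (10 * EdgeTwoColoring.optColors G 2 : ℝ) ≤ 16 * M.edgeSet.ncard +
        4 * EdgeTwoColoring.numEdgeComponents (G.deleteEdges M.edgeSet) := by
      exact_mod_cast h2 hG
    linarith
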